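/- Theorem (Completeness of BPR). Language. The set $\mathsf{At}$ of basic sentences consists of countably many propositional atoms together with the units $\bot,\top$. Formulas are built from $\mathsf{At}$ by $\wedge,\vee,\to$ and co-implication $\mapsfrom$. The sign $*\in\{+,-\}$ stands for "proof" ($+$) or "refutation" ($-$). The calculus. For sets $\Gamma,\Delta$ of formulas, $\Gamma;\Delta\vdash^*_{\mathsf{BPR}}\varphi$ means that there is a natural deduction of $\varphi$ in mode $*$ with undischarged assumptions in $\Gamma$ and undischarged counterassumptions in $\Delta$. An assumption $\varphi$ counts as a deduction of $+\varphi$, a counterassumption $\varphi$ as one of $-\varphi$. Writing $\pm\varphi$ for "$\varphi$ is proved/refuted", the rules are: $+\top$ and $-\bot$ (axioms); from $+\bot$, or from $-\top$, infer $*\varphi$; from $+\varphi$ and $-\varphi$ infer $*\psi$; $+\psi$ under discharged assumption $\varphi$ gives $+(\varphi\to\psi)$; $+(\varphi\to\psi),+\varphi$ give $+\psi$; $+\varphi,-\psi$ give $-(\varphi\to\psi)$; $-(\varphi\to\psi)$ gives $+\varphi$ and gives $-\psi$; $+\varphi,-\psi$ give $+(\varphi\mapsfrom\psi)$; $+(\varphi\mapsfrom\psi)$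 gives $+\varphi$ and gives $-\psi$; $-\varphi$ under discharged counterassumption $\psi$ gives $-(\varphi\mapsfrom\psi)$; $-(\varphi\mapsfrom\psi),-\psi$ give $-\varphi$; $+\varphi,+\psi$ give $+(\varphi\wedge\psi)$; $+(\varphi\wedge\psi)$ gives $+\varphi$ and gives $+\psi$; $-\varphi$, or $-\psi$, gives $-(\varphi\wedge\psi)$; $-(\varphi\wedge\psi)$ together with $*\chi$ under discharged counterassumption $\varphi$ and $*\chi$ under discharged counterassumption $\psi$ gives $*\chi$; $+\varphi$, or $+\psi$, gives $+(\varphi\vee\psi)$; $+(\varphi\vee\psi)$ together with $*\chi$ under discharged assumption $\varphi$ and $*\chi$ under discharged assumption $\psi$ gives $*\chi$; $-\varphi,-\psi$ give $-(\varphi\vee\psi)$; $-(\varphi\vee\psi)$ gives $-\varphi$ and gives $-\psi$. In every rule $*$ is replaced uniformly, and discharge may be vacuous. Bases. An atomic rule infers an atom $p$ in a given mode (proof rule or refutation rule) from a finite, possibly empty, list of premises; each premise is an atom $p_i$ in a given mode, in whose derivation a set $\Gamma^i$ of atomic assumptions and a set $\Delta^i$ of atomic counterassumptions may be discharged. A base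 is a set of atomic rules, and an extension of it is a superset. Write $\vdash^+_{\mathcal B}p$ (respectively $\vdash^-_{\mathcal B}p$) if $p$ has a proof (refutation) using rules of $\mathcal B$ without undischarged assumptions or counterassumptions. $\mathcal B$ is epistemically adequate if (i) $\nvdash^+_{\mathcal B}\bot$ and $\nvdash^-_{\mathcal B}\top$; (ii) $\mathcal B$ contains the proof axiom concluding $\top$ and the refutation axiom concluding $\bot$; and (iii) for every $p\in\mathsf{At}$, if $\vdash^+_{\mathcal B}p$ and $\vdash^-_{\mathcal B}p$ then $\vdash^+_{\mathcal B}\bot$ and $\vdash^-_{\mathcal B}\top$. Below, $\mathcal B,\mathcal C$ range over epistemically adequate bases only. Semantics. The relations $\Vdash^*_{\mathcal B}$ are defined by: - $\Vdash^*_{\mathcal B}p$ iff $\vdash^*_{\mathcal B}p$, for $p\in\mathsf{At}$; - $\Vdash^+_{\mathcal B}\varphi\wedge\psi$ iff $\Vdash^+_{\mathcal B}\varphi$ and $\Vdash^+_{\mathcal B}\psi$; - $\Vdash^-_{\mathcal B}\varphi\wedge\psi$ iff for all $\mathcal C\supseteq\mathcal B$, all $p\in\mathsf{At}$ and both signs $*$: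 if $\emptyset;\varphi\Vdash^*_{\mathcal C}p$ and $\emptyset;\psi\Vdash^*_{\mathcal C}p$ then $\Vdash^*_{\mathcal C}p$; - $\Vdash^+_{\mathcal B}\varphi\vee\psi$ iff for all $\mathcal C\supseteq\mathcal B$, all $p\in\mathsf{At}$ and both signs $*$: if $\varphi;\emptyset\Vdash^*_{\mathcal C}p$ and $\psi;\emptyset\Vdash^*_{\mathcal C}p$ then $\Vdash^*_{\mathcal C}p$; - $\Vdash^-_{\mathcal B}\varphi\vee\psi$ iff $\Vdash^-_{\mathcal B}\varphi$ and $\Vdash^-_{\mathcal B}\psi$; - $\Vdash^+_{\mathcal B}\varphi\to\psi$ iff $\varphi;\emptyset\Vdash^+_{\mathcal B}\psi$; and $\Vdash^-_{\mathcal B}\varphi\to\psi$ iff $\Vdash^+_{\mathcal B}\varphi$ and $\Vdash^-_{\mathcal B}\psi$; - $\Vdash^+_{\mathcal B}\varphi\mapsfrom\psi$ iff $\Vdash^+_{\mathcal B}\varphi$ and $\Vdash^-_{\mathcal B}\psi$; and $\Vdash^-_{\mathcal B}\varphi\mapsfrom\psi$ iff $\emptyset;\psi\Vdash^-_{\mathcal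 B}\varphi$; - for $\Gamma\cup\Delta\neq\emptyset$, $\Gamma;\Delta\Vdash^*_{\mathcal B}\chi$ iff for all $\mathcal C\supseteq\mathcal B$: if $\Vdash^+_{\mathcal C}\varphi$ for all $\varphi\in\Gamma$ and $\Vdash^-_{\mathcal C}\psi$ for all $\psi\in\Delta$, then $\Vdash^*_{\mathcal C}\chi$; and $\emptyset;\emptyset\Vdash^*_{\mathcal B}\chi$ means $\Vdash^*_{\mathcal B}\chi$. Finally, $\Gamma;\Delta\Vdash^*\varphi$ iff $\Gamma;\Delta\Vdash^*_{\mathcal B}\varphi$ for all epistemically adequate bases $\mathcal B$. Claim. Let $\Gamma,\Delta$ be finite sets of formulas, $\varphi$ a formula and $*\in\{+,-\}$. If $\Gamma;\Delta\Vdash^*\varphi$, then $\Gamma;\Delta\vdash^*_{\mathsf{BPR}}\varphi$. -/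

import Mathlib

namespace BPR

/-- Basic sentences: the units `⊥`, `⊤` and countably many atomic propositions. -/
inductive Atom : Type
  | bot : Atom
  | top : Atom
  | var (n : ℕ) : Atom

/-- Formulas. `coimp φ ψ` is the co-implication `φ ↤ ψ`, dual to implication. -/
inductive Formula : Type
  | atom (p : Atom) : Formula
  | and (φ ψ : Formula) : Formula
  | or (φ ψ : Formula) : Formula
  | imp (φ ψ : Formula) : Formula
  | coimp (φ ψ : Formula) : Formula

/-- `⊥` as a formula. -/
abbrev Formula.bot : Formula := .atom .bot

/-- `⊤` as a formula. -/
abbrev Formula.top : Formula := .atom .top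

/-- The two modes: `pos` for proofs (single line), `neg` for refutations (double line). -/
inductive Mode : Type
  | pos : Mode
  | neg : Mode

/-- `Derives Γ Δ s φ`: there is a natural deduction in BPR concluding `φ` in mode `s`, all of whose
undischarged assumptions are in `Γ` and undischarged counterassumptions in `Δ`.
A mode variable `s` on the conclusion of a rule stands for a dotted line. -/
inductive Derives : Set Formula → Set Formula → Mode → Formula → Prop
  | assumption {Γ Δ : Set Formula} {φ : Formula} : φ ∈ Γ → Derives Γ Δ .pos φ
  | counterassumption {Γ Δ : Set Formula} {φ : Formula} : φ ∈ Δ → Derives Γ Δ .neg φ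
  -- units
  | top_pos {Γ Δ : Set Formula} : Derives Γ Δ .pos .top
  | bot_neg {Γ Δ : Set Formula} : Derives Γ Δ .neg .bot
  | bot_pos {Γ Δ : Set Formula} {φ : Formula} (s : Mode) :
      Derives Γ Δ .pos .bot → Derives Γ Δ s φ
  | top_neg {Γ Δ : Set Formula} {φ : Formula} (s : Mode) :
      Derives Γ Δ .neg .top → Derives Γ Δ s φ
  -- implication
  | imp_pos_intro {Γ Δ : Set Formula} {φ ψ : Formula} :
      Derives (insert φ Γ) Δ .pos ψ → Derives Γ Δ .pos (.imp φ ψ)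
  | imp_pos_elim {Γ Δ : Set Formula} {φ ψ : Formula} :
      Derives Γ Δ .pos (.imp φ ψ) → Derives Γ Δ .pos φ → Derives Γ Δ .pos ψ
  | imp_neg_intro {Γ Δ : Set Formula} {φ ψ : Formula} :
      Derives Γ Δ .pos φ → Derives Γ Δ .neg ψ → Derives Γ Δ .neg (.imp φ ψ)
  | imp_neg_elim_left {Γ Δ : Set Formula} {φ ψ : Formula} :
      Derives Γ Δ .neg (.imp φ ψ) → Derives Γ Δ .pos φ
  | imp_neg_elim_right {Γ Δ : Set Formula} {φ ψ : Formula} :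
      Derives Γ Δ .neg (.imp φ ψ) → Derives Γ Δ .neg ψ
  -- co-implication
  | coimp_pos_intro {Γ Δ : Set Formula} {φ ψ : Formula} :
      Derives Γ Δ .pos φ → Derives Γ Δ .neg ψ → Derives Γ Δ .pos (.coimp φ ψ)
  | coimp_pos_elim_left {Γ Δ : Set Formula} {φ ψ : Formula} :
      Derives Γ Δ .pos (.coimp φ ψ) → Derives Γ Δ .pos φ
  | coimp_pos_elim_right {Γ Δ : Set Formula} {φ ψ : Formula} :
      Derives Γ Δ .pos (.coimp φ ψ) → Derives Γ Δ .neg ψ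
  | coimp_neg_intro {Γ Δ : Set Formula} {φ ψ : Formula} :
      Derives Γ (insert ψ Δ) .neg φ → Derives Γ Δ .neg (.coimp φ ψ)
  | coimp_neg_elim {Γ Δ : Set Formula} {φ ψ : Formula} :
      Derives Γ Δ .neg (.coimp φ ψ) → Derives Γ Δ .neg ψ → Derives Γ Δ .neg φ
  -- conjunction
  | and_pos_intro {Γ Δ : Set Formula} {φ ψ : Formula} :
      Derives Γ Δ .pos φ → Derives Γ Δ .pos ψ → Derives Γ Δ .pos (.and φ ψ)
  | and_pos_elim_left {Γ Δ : Set Formula} {φ ψ : Formula} :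
      Derives Γ Δ .pos (.and φ ψ) → Derives Γ Δ .pos φ
  | and_pos_elim_right {Γ Δ : Set Formula} {φ ψ : Formula} :
      Derives Γ Δ .pos (.and φ ψ) → Derives Γ Δ .pos ψ
  | and_neg_intro_left {Γ Δ : Set Formula} {φ ψ : Formula} :
      Derives Γ Δ .neg φ → Derives Γ Δ .neg (.and φ ψ)
  | and_neg_intro_right {Γ Δ : Set Formula} {φ ψ : Formula} :
      Derives Γ Δ .neg ψ → Derives Γ Δ .neg (.and φ ψ)
  | and_neg_elim {Γ Δ : Set Formula} {φ ψ χ : Formula} (s : Mode) :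
      Derives Γ Δ .neg (.and φ ψ) → Derives Γ (insert φ Δ) s χ → Derives Γ (insert ψ Δ) s χ →
      Derives Γ Δ s χ
  -- disjunction
  | or_pos_intro_left {Γ Δ : Set Formula} {φ ψ : Formula} :
      Derives Γ Δ .pos φ → Derives Γ Δ .pos (.or φ ψ)
  | or_pos_intro_right {Γ Δ : Set Formula} {φ ψ : Formula} :
      Derives Γ Δ .pos ψ → Derives Γ Δ .pos (.or φ ψ)
  | or_pos_elim {Γ Δ : Set Formula} {φ ψ χ : Formula} (s : Mode) :
      Derives Γ Δ .pos (.or φ ψ) → Derives (insert φ Γ) Δ s χ → Derives (insert ψ Γ) Δ s χ →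
      Derives Γ Δ s χ
  | or_neg_intro {Γ Δ : Set Formula} {φ ψ : Formula} :
      Derives Γ Δ .neg φ → Derives Γ Δ .neg ψ → Derives Γ Δ .neg (.or φ ψ)
  | or_neg_elim_left {Γ Δ : Set Formula} {φ ψ : Formula} :
      Derives Γ Δ .neg (.or φ ψ) → Derives Γ Δ .neg φ
  | or_neg_elim_right {Γ Δ : Set Formula} {φ ψ : Formula} :
      Derives Γ Δ .neg (.or φ ψ) → Derives Γ Δ .neg ψ
  -- coordination of proofs and refutations
  | pr {Γ Δ : Set Formula} {φ ψ : Formula} (s : Mode) :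
      Derives Γ Δ .pos φ → Derives Γ Δ .neg φ → Derives Γ Δ s ψ

/-- A premise of an atomic rule: the atom `concl`, to be established in mode `mode`, where the
assumptions `hyps` and the counterassumptions `counterhyps` may be discharged. -/
structure AtomicPremise : Type where
  hyps : Set Atom
  counterhyps : Set Atom
  mode : Mode
  concl : Atom

/-- An atomic rule; it is a proof rule or a refutation rule according to `mode`, and an atomic axiom
if `premises` is empty. -/
structure AtomicRule : Type where
  premises : List AtomicPremise
  mode : Mode
  concl : Atom

/-- A (bilateral) base is a set of atomic rules; extension of bases is `⊆`. -/
abbrev Base : Type := Set AtomicRule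

/-- `B.Derives Γ Δ s p`: there is a deduction of the atom `p` in mode `s`, using only rules of `B`,
with undischarged assumptions in `Γ` and undischarged counterassumptions in `Δ`. -/
inductive Base.Derives (B : Base) : Set Atom → Set Atom → Mode → Atom → Prop
  | assumption {Γ Δ : Set Atom} {p : Atom} : p ∈ Γ → Base.Derives B Γ Δ .pos p
  | counterassumption {Γ Δ : Set Atom} {p : Atom} : p ∈ Δ → Base.Derives B Γ Δ .neg p
  | rule {Γ Δ : Set Atom} (r : AtomicRule) : r ∈ B →
      (∀ q ∈ r.premises, Base.Derives B (Γ ∪ q.hyps) (Δ ∪ q.counterhyps) q.mode q.concl) →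
      Base.Derives B Γ Δ r.mode r.concl

/-- Existence of an atomic proof (`s = pos`) or an atomic refutation (`s = neg`) of `p` in `B`. -/
def Base.Proves (B : Base) (s : Mode) (p : Atom) : Prop :=
  B.Derives ∅ ∅ s p

def Base.LogicallyConsistent (B : Base) : Prop :=
  ¬ B.Proves .pos .bot ∧ ¬ B.Proves .neg .top

def Base.UnitComplete (B : Base) : Prop :=
  (⟨[], .pos, .top⟩ : AtomicRule) ∈ B ∧ (⟨[], .neg, .bot⟩ : AtomicRule) ∈ B

/-- Closure under the rules leading from a proof and a refutation of an atom `p` to a proof of `⊥`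
and to a refutation of `⊤`. -/
def Base.EpistemicallyConsistent (B : Base) : Prop :=
  ∀ p : Atom, B.Proves .pos p → B.Proves .neg p → B.Proves .pos .bot ∧ B.Proves .neg .top

structure Base.Adequate (B : Base) : Prop where
  logicallyConsistent : B.LogicallyConsistent
  unitComplete : B.UnitComplete
  epistemicallyConsistent : B.EpistemicallyConsistent

/-- `P` implies `Q` at every epistemically adequate extension of `B`. -/
def Base.Forces (B : Base) (P Q : Base → Prop) : Prop :=
  ∀ C : Base, B ⊆ C → C.Adequate → P C → Q C

/-- `Supports φ s B`: the base `B` supports `φ` in mode `s`, i.e. `⊩⁺_B φ` or `⊩⁻_B φ`. -/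
def Supports : Formula → Mode → Base → Prop
  | .atom p, s, B => B.Proves s p
  | .and φ ψ, .pos, B => Supports φ .pos B ∧ Supports ψ .pos B
  | .and φ ψ, .neg, B => ∀ C : Base, B ⊆ C → C.Adequate → ∀ (p : Atom) (s : Mode),
      C.Forces (Supports φ .neg) (fun D => D.Proves s p) →
      C.Forces (Supports ψ .neg) (fun D => D.Proves s p) → C.Proves s p
  | .or φ ψ, .pos, B => ∀ C : Base, B ⊆ C → C.Adequate → ∀ (p : Atom) (s : Mode),
      C.Forces (Supports φ .pos) (fun D => D.Proves s p) →
      C.Forces (Supports ψ .pos) (fun D => D.Proves s p) → C.Proves s p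
  | .or φ ψ, .neg, B => Supports φ .neg B ∧ Supports ψ .neg B
  | .imp φ ψ, .pos, B => B.Forces (Supports φ .pos) (Supports ψ .pos)
  | .imp φ ψ, .neg, B => Supports φ .pos B ∧ Supports ψ .neg B
  | .coimp φ ψ, .pos, B => Supports φ .pos B ∧ Supports ψ .neg B
  | .coimp φ ψ, .neg, B => B.Forces (Supports ψ .neg) (Supports φ .neg)

/-- `Γ; Δ ⊩ˢ_B χ`. Without premises this is support of `χ` at `B`; otherwise it quantifies over the
epistemically adequate extensions of `B`. -/
def SupportsFrom (Γ Δ : Set Formula) (B : Base) (s : Mode) (χ : Formula) : Prop :=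
  (Γ ∪ Δ = ∅ → Supports χ s B) ∧
  ((Γ ∪ Δ).Nonempty →
    B.Forces (fun C => (∀ φ ∈ Γ, Supports φ .pos C) ∧ (∀ ψ ∈ Δ, Supports ψ .neg C))
      (Supports χ s))

/-- `Γ; Δ ⊩ˢ χ`: support at every epistemically adequate base. -/
def Valid (Γ Δ : Set Formula) (s : Mode) (χ : Formula) : Prop :=
  ∀ B : Base, B.Adequate → SupportsFrom Γ Δ B s χ

end BPR

namespace BPR

open Set

/-! A base is built in which atoms name formulas. Finitely many variables occur in the formulas
involved; these and the units name themselves, and the remaining variables name all formulas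
(`readingOf`). Under such a reading `β`, `admissible β` contains every atomic rule that is
admissible in BPR, in particular atomic copies of all its introductions and eliminations. Hence,
over adequate extensions, support of a formula agrees with provability of any of its names
(`Reading.supports_iff`).

Adding axioms for the names of `Γ` and `Δ` then turns validity into an atomic derivation, which
`derives_of_admissible` reads back into BPR. Extensions that fail to be adequate do no harm: they
prove everything (`Reading.adequate_or`). -/

/-! ### Countability of the language -/

instance : Countable Atom := by
  let f : Atom → Option (Option ℕ)
    | .bot => none
    | .top => some none
    | .var n => some (some n)
  refine Function.Injective.countable (f := f) ?_
  rintro (_ | _ | m) (_ | _ | n) h <;> simp_all [f]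

/-- An injective numbering of formulas, relative to a numbering of the atoms. -/
def Formula.code (e : Atom → ℕ) : Formula → ℕ
  | .atom p => Nat.pair 0 (e p)
  | .and φ ψ => Nat.pair 1 (Nat.pair (φ.code e) (ψ.code e))
  | .or φ ψ => Nat.pair 2 (Nat.pair (φ.code e) (ψ.code e))
  | .imp φ ψ => Nat.pair 3 (Nat.pair (φ.code e) (ψ.code e))
  | .coimp φ ψ => Nat.pair 4 (Nat.pair (φ.code e) (ψ.code e))

theorem Formula.code_injective {e : Atom → ℕ} (he : Function.Injective e) :
    Function.Injective (Formula.code e) := by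
  intro φ
  induction φ with
  | atom p =>
    intro χ h
    cases χ <;> simp [Formula.code, Nat.pair_eq_pair] at h
    rw [he h]
  | and φ ψ ih₁ ih₂ | or φ ψ ih₁ ih₂ | imp φ ψ ih₁ ih₂ | coimp φ ψ ih₁ ih₂ =>
    intro χ h
    cases χ <;> simp [Formula.code, Nat.pair_eq_pair] at h
    rw [ih₁ h.1, ih₂ h.2]

instance : Countable Formula := by
  obtain ⟨e, he⟩ := exists_injective_nat Atom
  exact (Formula.code_injective he).countable

/-! ### Structural properties of atomic derivability -/

namespace Base

variable {B C : Base} {Γ Δ Γ' Δ' : Set Atom} {s : Mode} {p : Atom}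

theorem Derives.mono (hBC : B ⊆ C) (h : B.Derives Γ Δ s p) (hΓ : Γ ⊆ Γ') (hΔ : Δ ⊆ Δ') :
    C.Derives Γ' Δ' s p := by
  induction h generalizing Γ' Δ' with
  | assumption h => exact .assumption (hΓ h)
  | counterassumption h => exact .counterassumption (hΔ h)
  | rule r hr _ ih =>
    exact .rule r (hBC hr) fun q hq =>
      ih q hq (union_subset_union_left _ hΓ) (union_subset_union_left _ hΔ)

theorem Proves.mono (hBC : B ⊆ C) (h : B.Proves s p) : C.Proves s p :=
  Derives.mono hBC h subset_rfl subset_rfl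

/-- The base `B` extended by proof axioms for `Γ` and refutation axioms for `Δ`. -/
def withAxioms (B : Base) (Γ Δ : Set Atom) : Base :=
  B ∪ {r | r.premises = [] ∧ (r.mode = .pos ∧ r.concl ∈ Γ ∨ r.mode = .neg ∧ r.concl ∈ Δ)}

theorem subset_withAxioms : B ⊆ B.withAxioms Γ Δ := subset_union_left

theorem withAxioms_proves_pos (h : p ∈ Γ) : (B.withAxioms Γ Δ).Proves .pos p :=
  .rule ⟨[], .pos, p⟩ (.inr ⟨rfl, .inl ⟨rfl, h⟩⟩) (by simp)

theorem withAxioms_proves_neg (h : p ∈ Δ) : (B.withAxioms Γ Δ).Proves .neg p :=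
  .rule ⟨[], .neg, p⟩ (.inr ⟨rfl, .inr ⟨rfl, h⟩⟩) (by simp)

/-- Each use of an added axiom is replaced by an open assumption or counterassumption. -/
theorem Derives.of_withAxioms (h : (B.withAxioms Γ' Δ').Derives Γ Δ s p) :
    B.Derives (Γ ∪ Γ') (Δ ∪ Δ') s p := by
  induction h with
  | assumption h => exact .assumption (.inl h)
  | counterassumption h => exact .counterassumption (.inl h)
  | rule r hr _ ih =>
    rcases hr with hr | ⟨-, ⟨hm, hc⟩ | ⟨hm, hc⟩⟩
    · refine .rule r hr fun q hq => (ih q hq).mono subset_rfl ?_ ?_ <;>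
        rw [union_right_comm]
    · rw [hm]; exact .assumption (.inr hc)
    · rw [hm]; exact .counterassumption (.inr hc)

theorem Proves.of_withAxioms (h : (B.withAxioms Γ Δ).Proves s p) : B.Derives Γ Δ s p := by
  simpa using Derives.of_withAxioms h

end Base

/-! ### The base of admissible rules -/

/-- The atomic rules that become admissible in BPR when atoms are read as formulas via `β`. -/
def admissible (β : Atom → Formula) : Base :=
  {r | ∀ Γ Δ : Set Formula,
    (∀ q ∈ r.premises,
      Derives (Γ ∪ β '' q.hyps) (Δ ∪ β '' q.counterhyps) q.mode (β q.concl)) →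
    Derives Γ Δ r.mode (β r.concl)}

/-- Admissibility is required in all contexts, so it applies in the one reached at each rule of the
atomic derivation. -/
theorem derives_of_admissible {β : Atom → Formula} {Γ Δ : Set Atom} {s : Mode} {p : Atom}
    (h : (admissible β).Derives Γ Δ s p) : Derives (β '' Γ) (β '' Δ) s (β p) := by
  induction h with
  | assumption h => exact .assumption (mem_image_of_mem β h)
  | counterassumption h => exact .counterassumption (mem_image_of_mem β h)
  | rule r hr _ ih =>
    refine hr _ _ fun q hq => ?_
    simpa only [image_union] using ih q hq

/-- Application of an admissible two-premise rule without discharge. -/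
theorem Base.Derives.step₂ {β : Atom → Formula} {C : Base} (hC : admissible β ⊆ C)
    {Γ Δ : Set Atom} {s₁ s₂ t : Mode} {a b c : Atom}
    (hr : ∀ Γ Δ, BPR.Derives Γ Δ s₁ (β a) → BPR.Derives Γ Δ s₂ (β b) → BPR.Derives Γ Δ t (β c))
    (ha : C.Derives Γ Δ s₁ a) (hb : C.Derives Γ Δ s₂ b) : C.Derives Γ Δ t c := by
  refine .rule ⟨[⟨∅, ∅, s₁, a⟩, ⟨∅, ∅, s₂, b⟩], t, c⟩ (hC fun Γ Δ h => ?_) ?_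
  · simp only [List.mem_cons, List.not_mem_nil, or_false, forall_eq_or_imp, forall_eq,
      image_empty, union_empty] at h
    exact hr Γ Δ h.1 h.2
  · simpa using ⟨ha, hb⟩

theorem Base.Derives.step {β : Atom → Formula} {C : Base} (hC : admissible β ⊆ C)
    {Γ Δ : Set Atom} {s t : Mode} {a c : Atom}
    (hr : ∀ Γ Δ, BPR.Derives Γ Δ s (β a) → BPR.Derives Γ Δ t (β c))
    (ha : C.Derives Γ Δ s a) : C.Derives Γ Δ t c :=
  Base.Derives.step₂ hC (fun Γ Δ h _ => hr Γ Δ h) ha ha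

/-! ### Adequacy or triviality of extensions -/

/-- Readings of atoms as formulas that reach every formula and fix the units. -/
structure Reading (β : Atom → Formula) : Prop where
  surjective : Function.Surjective β
  bot : β .bot = .bot
  top : β .top = .top

/-- The explosion rules for the units and `pr` have atomic copies in `C`, so the only way to miss
adequacy is to prove `⊥` or refute `⊤`, and then everything follows. -/
theorem Reading.adequate_or {β : Atom → Formula} (hβ : Reading β) {C : Base}
    (hC : admissible β ⊆ C) : C.Adequate ∨ ∀ s p, C.Proves s p := by
  by_cases hp : C.Proves .pos .bot
  · exact .inr fun s p => .step hC (fun Γ Δ h => .bot_pos s (hβ.bot ▸ h)) hp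
  by_cases hn : C.Proves .neg .top
  · exact .inr fun s p => .step hC (fun Γ Δ h => .top_neg s (hβ.top ▸ h)) hn
  refine .inl ⟨⟨hp, hn⟩, ⟨hC fun Γ Δ _ => ?_, hC fun Γ Δ _ => ?_⟩, fun p h₁ h₂ => ⟨?_, ?_⟩⟩
  · simpa only [hβ.top] using BPR.Derives.top_pos
  · simpa only [hβ.bot] using BPR.Derives.bot_neg
  · exact .step₂ hC (fun Γ Δ => .pr _) h₁ h₂
  · exact .step₂ hC (fun Γ Δ => .pr _) h₁ h₂

/-- The hypothesis is tested at `C` with the axiom `a` added; the axiom is then traded for an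
assumption, available for discharge. -/
theorem Reading.derives_of_forces_pos {β : Atom → Formula} (hβ : Reading β) {C : Base}
    (hC : admissible β ⊆ C) {a b : Atom} {s : Mode}
    (h : C.Forces (fun D => D.Proves .pos a) (fun D => D.Proves s b)) :
    C.Derives {a} ∅ s b := by
  refine Base.Proves.of_withAxioms ?_
  rcases hβ.adequate_or (hC.trans (Base.subset_withAxioms (Γ := {a}) (Δ := ∅))) with hD | hD
  · exact h _ Base.subset_withAxioms hD (Base.withAxioms_proves_pos rfl)
  · exact hD s b

theorem Reading.derives_of_forces_neg {β : Atom → Formula} (hβ : Reading β) {C : Base}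
    (hC : admissible β ⊆ C) {a b : Atom} {s : Mode}
    (h : C.Forces (fun D => D.Proves .neg a) (fun D => D.Proves s b)) :
    C.Derives ∅ {a} s b := by
  refine Base.Proves.of_withAxioms ?_
  rcases hβ.adequate_or (hC.trans (Base.subset_withAxioms (Γ := ∅) (Δ := {a}))) with hD | hD
  · exact h _ Base.subset_withAxioms hD (Base.withAxioms_proves_neg rfl)
  · exact hD s b

/-! ### Support as provability of a name -/

/-- `β` reads every atom occurring in the formula as itself. -/
def FixesAtoms (β : Atom → Formula) : Formula → Prop
  | .atom p => β p = .atom p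
  | .and φ ψ | .or φ ψ | .imp φ ψ | .coimp φ ψ => FixesAtoms β φ ∧ FixesAtoms β ψ

/-- Over the admissible rules, support of a formula is provability of any atom read as it. -/
theorem Reading.supports_iff {β : Atom → Formula} (hβ : Reading β) (φ : Formula)
    (hφ : FixesAtoms β φ) {C : Base} (hC : admissible β ⊆ C) (hCa : C.Adequate) (s : Mode)
    {c : Atom} (hc : β c = φ) : Supports φ s C ↔ C.Proves s c := by
  induction φ generalizing C s c with
  | atom p =>
    -- The atoms `p` and `c` may differ, but having the same reading makes each inferable from the
    -- other.
    have hp : β p = β c := hc ▸ hφ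
    exact ⟨.step hC fun _ _ h => hp ▸ h, .step hC fun _ _ h => hp ▸ h⟩
  | and φ ψ ih₁ ih₂ =>
    obtain ⟨a, rfl⟩ := hβ.surjective φ
    obtain ⟨b, rfl⟩ := hβ.surjective ψ
    cases s with
    | pos =>
      simp only [Supports, ih₁ hφ.1 hC hCa _ rfl, ih₂ hφ.2 hC hCa _ rfl]
      exact ⟨fun h => .step₂ hC (fun _ _ h₁ h₂ => hc ▸ .and_pos_intro h₁ h₂) h.1 h.2,
        fun h => ⟨.step hC (fun _ _ h => .and_pos_elim_left (hc ▸ h)) h,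
          .step hC (fun _ _ h => .and_pos_elim_right (hc ▸ h)) h⟩⟩
    | neg =>
      -- The atomic test conclusion is taken to be `c`, the name of the conjunction itself.
      refine ⟨fun h => h C subset_rfl hCa c .neg ?_ ?_, fun h D hCD hDa p s h₁ h₂ => ?_⟩
      · intro D hCD hDa h
        exact .step (hC.trans hCD) (fun _ _ h => hc ▸ .and_neg_intro_left h)
          ((ih₁ hφ.1 (hC.trans hCD) hDa _ rfl).1 h)
      · intro D hCD hDa h
        exact .step (hC.trans hCD) (fun _ _ h => hc ▸ .and_neg_intro_right h)
          ((ih₂ hφ.2 (hC.trans hCD) hDa _ rfl).1 h)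
      · have hD := hC.trans hCD
        have h₁ := hβ.derives_of_forces_neg hD fun E hDE hEa h =>
          h₁ E hDE hEa ((ih₁ hφ.1 (hD.trans hDE) hEa _ rfl).2 h)
        have h₂ := hβ.derives_of_forces_neg hD fun E hDE hEa h =>
          h₂ E hDE hEa ((ih₂ hφ.2 (hD.trans hDE) hEa _ rfl).2 h)
        -- Atomic copy of `and_neg_elim`, discharging the names of the two conjuncts.
        refine .rule ⟨[⟨∅, ∅, .neg, c⟩, ⟨∅, {a}, s, p⟩, ⟨∅, {b}, s, p⟩], s, p⟩
          (hD fun Γ Δ h => ?_) ?_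
        · simp only [List.mem_cons, List.not_mem_nil, or_false, forall_eq_or_imp, forall_eq,
            image_empty, union_empty, image_singleton, union_singleton, hc] at h
          exact .and_neg_elim s h.1 h.2.1 h.2.2
        · simpa using ⟨h.mono hCD, h₁, h₂⟩
  | or φ ψ ih₁ ih₂ =>
    obtain ⟨a, rfl⟩ := hβ.surjective φ
    obtain ⟨b, rfl⟩ := hβ.surjective ψ
    cases s with
    | neg =>
      simp only [Supports, ih₁ hφ.1 hC hCa _ rfl, ih₂ hφ.2 hC hCa _ rfl]
      exact ⟨fun h => .step₂ hC (fun _ _ h₁ h₂ => hc ▸ .or_neg_intro h₁ h₂) h.1 h.2,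
        fun h => ⟨.step hC (fun _ _ h => .or_neg_elim_left (hc ▸ h)) h,
          .step hC (fun _ _ h => .or_neg_elim_right (hc ▸ h)) h⟩⟩
    | pos =>
      refine ⟨fun h => h C subset_rfl hCa c .pos ?_ ?_, fun h D hCD hDa p s h₁ h₂ => ?_⟩
      · intro D hCD hDa h
        exact .step (hC.trans hCD) (fun _ _ h => hc ▸ .or_pos_intro_left h)
          ((ih₁ hφ.1 (hC.trans hCD) hDa _ rfl).1 h)
      · intro D hCD hDa h
        exact .step (hC.trans hCD) (fun _ _ h => hc ▸ .or_pos_intro_right h)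
          ((ih₂ hφ.2 (hC.trans hCD) hDa _ rfl).1 h)
      · have hD := hC.trans hCD
        have h₁ := hβ.derives_of_forces_pos hD fun E hDE hEa h =>
          h₁ E hDE hEa ((ih₁ hφ.1 (hD.trans hDE) hEa _ rfl).2 h)
        have h₂ := hβ.derives_of_forces_pos hD fun E hDE hEa h =>
          h₂ E hDE hEa ((ih₂ hφ.2 (hD.trans hDE) hEa _ rfl).2 h)
        refine .rule ⟨[⟨∅, ∅, .pos, c⟩, ⟨{a}, ∅, s, p⟩, ⟨{b}, ∅, s, p⟩], s, p⟩
          (hD fun Γ Δ h => ?_) ?_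
        · simp only [List.mem_cons, List.not_mem_nil, or_false, forall_eq_or_imp, forall_eq,
            image_empty, union_empty, image_singleton, union_singleton, hc] at h
          exact .or_pos_elim s h.1 h.2.1 h.2.2
        · simpa using ⟨h.mono hCD, h₁, h₂⟩
  | imp φ ψ ih₁ ih₂ =>
    obtain ⟨a, rfl⟩ := hβ.surjective φ
    obtain ⟨b, rfl⟩ := hβ.surjective ψ
    cases s with
    | neg =>
      simp only [Supports, ih₁ hφ.1 hC hCa _ rfl, ih₂ hφ.2 hC hCa _ rfl]
      exact ⟨fun h => .step₂ hC (fun _ _ h₁ h₂ => hc ▸ .imp_neg_intro h₁ h₂) h.1 h.2,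
        fun h => ⟨.step hC (fun _ _ h => .imp_neg_elim_left (hc ▸ h)) h,
          .step hC (fun _ _ h => .imp_neg_elim_right (hc ▸ h)) h⟩⟩
    | pos =>
      refine ⟨fun h => ?_, fun h D hCD hDa h₁ => ?_⟩
      · have h := hβ.derives_of_forces_pos hC fun D hCD hDa h₁ =>
          (ih₂ hφ.2 (hC.trans hCD) hDa _ rfl).1
            (h D hCD hDa ((ih₁ hφ.1 (hC.trans hCD) hDa _ rfl).2 h₁))
        refine .rule ⟨[⟨{a}, ∅, .pos, b⟩], .pos, c⟩ (hC fun Γ Δ h => ?_) (by simpa using h)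
        simp only [List.mem_singleton, forall_eq, image_empty, union_empty, image_singleton,
          union_singleton] at h
        exact hc ▸ .imp_pos_intro h
      · have hD := hC.trans hCD
        exact (ih₂ hφ.2 hD hDa _ rfl).2 (.step₂ hD
          (fun _ _ h h₁ => .imp_pos_elim (hc ▸ h) h₁) (h.mono hCD)
          ((ih₁ hφ.1 hD hDa _ rfl).1 h₁))
  | coimp φ ψ ih₁ ih₂ =>
    obtain ⟨a, rfl⟩ := hβ.surjective φ
    obtain ⟨b, rfl⟩ := hβ.surjective ψ
    cases s with
    | pos =>
      simp only [Supports, ih₁ hφ.1 hC hCa _ rfl, ih₂ hφ.2 hC hCa _ rfl]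
      exact ⟨fun h => .step₂ hC (fun _ _ h₁ h₂ => hc ▸ .coimp_pos_intro h₁ h₂) h.1 h.2,
        fun h => ⟨.step hC (fun _ _ h => .coimp_pos_elim_left (hc ▸ h)) h,
          .step hC (fun _ _ h => .coimp_pos_elim_right (hc ▸ h)) h⟩⟩
    | neg =>
      refine ⟨fun h => ?_, fun h D hCD hDa h₂ => ?_⟩
      · have h := hβ.derives_of_forces_neg hC fun D hCD hDa h₂ =>
          (ih₁ hφ.1 (hC.trans hCD) hDa _ rfl).1
            (h D hCD hDa ((ih₂ hφ.2 (hC.trans hCD) hDa _ rfl).2 h₂))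
        refine .rule ⟨[⟨∅, {b}, .neg, a⟩], .neg, c⟩ (hC fun Γ Δ h => ?_) (by simpa using h)
        simp only [List.mem_singleton, forall_eq, image_empty, union_empty, image_singleton,
          union_singleton] at h
        exact hc ▸ .coimp_neg_intro h
      · have hD := hC.trans hCD
        exact (ih₁ hφ.1 hD hDa _ rfl).2 (.step₂ hD
          (fun _ _ h h₂ => .coimp_neg_elim (hc ▸ h) h₂) (h.mono hCD)
          ((ih₂ hφ.2 hD hDa _ rfl).1 h₂))

/-- Completeness relative to a reading that fixes the atoms of the formulas involved. -/
theorem Reading.derives_of_valid {β : Atom → Formula} (hβ : Reading β) {Γ Δ : Set Formula}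
    {s : Mode} {φ : Formula} (hΓ : ∀ γ ∈ Γ, FixesAtoms β γ) (hΔ : ∀ δ ∈ Δ, FixesAtoms β δ)
    (hφ : FixesAtoms β φ) (h : Valid Γ Δ s φ) : Derives Γ Δ s φ := by
  obtain ⟨c, hc⟩ := hβ.surjective φ
  have hB := Base.subset_withAxioms (B := admissible β) (Γ := β ⁻¹' Γ) (Δ := β ⁻¹' Δ)
  have key : ((admissible β).withAxioms (β ⁻¹' Γ) (β ⁻¹' Δ)).Proves s c := by
    rcases hβ.adequate_or hB with hA | hA
    · refine (hβ.supports_iff φ hφ hB hA s hc).1 ?_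
      rcases (Γ ∪ Δ).eq_empty_or_nonempty with he | hne
      · exact (h _ hA).1 he
      · refine (h _ hA).2 hne _ subset_rfl hA ⟨fun γ hγ => ?_, fun δ hδ => ?_⟩
        · obtain ⟨a, rfl⟩ := hβ.surjective γ
          exact (hβ.supports_iff _ (hΓ _ hγ) hB hA _ rfl).2 (Base.withAxioms_proves_pos hγ)
        · obtain ⟨a, rfl⟩ := hβ.surjective δ
          exact (hβ.supports_iff _ (hΔ _ hδ) hB hA _ rfl).2 (Base.withAxioms_proves_neg hδ)
    · exact hA s c
  have := derives_of_admissible key.of_withAxioms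
  -- Since every formula has a name, reading back the names of `Γ` and `Δ` gives exactly `Γ` and
  -- `Δ`.
  rwa [image_preimage_eq _ hβ.surjective, image_preimage_eq _ hβ.surjective, hc] at this

/-! ### Existence of readings -/

/-- A strict upper bound for the indices of the propositional variables of a formula. -/
def Formula.varBound : Formula → ℕ
  | .atom (.var n) => n + 1
  | .atom _ => 0
  | .and φ ψ | .or φ ψ | .imp φ ψ | .coimp φ ψ => max φ.varBound ψ.varBound

/-- Variables below `M` are read as themselves, the others through the enumeration `f`. -/
def readingOf (M : ℕ) (f : ℕ → Formula) : Atom → Formula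
  | .bot => .bot
  | .top => .top
  | .var n => if n < M then .atom (.var n) else f (n - M)

theorem reading_readingOf {M : ℕ} {f : ℕ → Formula} (hf : Function.Surjective f) :
    Reading (readingOf M f) where
  surjective φ := by
    obtain ⟨n, rfl⟩ := hf φ
    exact ⟨.var (M + n), by simp [readingOf]⟩
  bot := rfl
  top := rfl

theorem fixesAtoms_readingOf {M : ℕ} {f : ℕ → Formula} {φ : Formula} (h : φ.varBound ≤ M) :
    FixesAtoms (readingOf M f) φ := by
  induction φ with
  | atom p =>
    cases p with
    | bot | top => rfl
    -- Here `h` is `n + 1 ≤ M`, which is `n < M` by definition.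
    | var n => exact if_pos h
  | and φ ψ ih₁ ih₂ | or φ ψ ih₁ ih₂ | imp φ ψ ih₁ ih₂ | coimp φ ψ ih₁ ih₂ =>
    exact ⟨ih₁ ((le_max_left _ _).trans h), ih₂ ((le_max_right _ _).trans h)⟩

end BPR

theorem mainTheorem2 (Γ Δ : Set BPR.Formula) (hΓ : Γ.Finite) (hΔ : Δ.Finite)
    (s : BPR.Mode) (φ : BPR.Formula) (h : BPR.Valid Γ Δ s φ) :
    BPR.Derives Γ Δ s φ := by
  -- Finiteness of `Γ` and `Δ` leaves the variables from `M` on free to serve as names.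
  obtain ⟨M, hM⟩ := (((hΓ.union hΔ).insert φ).image BPR.Formula.varBound).bddAbove
  have hM' : ∀ χ ∈ insert φ (Γ ∪ Δ), χ.varBound ≤ M := fun χ hχ =>
    hM (Set.mem_image_of_mem _ hχ)
  have : Nonempty BPR.Formula := ⟨.bot⟩
  obtain ⟨f, hf⟩ := exists_surjective_nat BPR.Formula
  exact (BPR.reading_readingOf hf).derives_of_valid
    (fun γ hγ => BPR.fixesAtoms_readingOf (hM' γ (.inr (.inl hγ))))
    (fun δ hδ => BPR.fixesAtoms_readingOf (hM' δ (.inr (.inr hδ))))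
    (BPR.fixesAtoms_readingOf (hM' φ (.inl rfl))) h
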